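/- **Definitions.** For a finite simple graph $\Gamma$, an $L(2,1)$-labelling is a function $f:V(\Gamma)\to\mathbb{Z}$ such that $|f(a)-f(b)|\ge 2$ whenever $d(a,b)=1$ and $|f(a)-f(b)|\ge 1$ whenever $d(a,b)=2$. The lambda number $\lambda(\Gamma)$ is the minimum of $\max_x f(x)-\min_x f(x)$ over all $L(2,1)$-labellings $f$ of $\Gamma$. The power graph $\Gamma_G$ of a finite group $G$ has vertex set $G$, and two distinct elements are adjacent if and only if one of them is a positive integer power of the other. A generalized quaternion $2$-group is a group isomorphic to $\langle x,y : x^{2^e}=1,\ x^{2^{e-1}}=y^2,\ y^{-1}xy=x^{-1}\rangle$ (of order $2^{e+1}$) for some $e\ge 2$. **Theorem.** Let $p$ be a prime and let $G$ be a finite $p$-group. If $|G|\neq 2$, then $\lambda(\Gamma_G)=|G|$ if and only if $G$ is neither cyclic nor a generalized quaternion $2$-group. Moreover, for every finite $p$-group $G$ of exponent $p^e$ (including $|G|=2$), $$\lambda(\Gamma_G)=\begin{cases}2(p^e-1) & \text{if } G \text{ is cyclic},\\ |G|+1 & \text{if } p=2 \text{ and } G \text{ is generalized quaternion},\\ |G|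 & \text{otherwise.}\end{cases}$$ -/

import Mathlib

namespace LambdaNumber

/-- `f` is an `L(j,k)`-labelling of `Γ`: labels differ by at least `j` at distance `1` and by at
least `k` at distance `2`. -/
def IsLabelling {V : Type*} (Γ : SimpleGraph V) (j k : ℕ) (f : V → ℤ) : Prop :=
  (∀ a b : V, Γ.dist a b = 1 → (j : ℤ) ≤ |f a - f b|) ∧
  (∀ a b : V, Γ.dist a b = 2 → (k : ℤ) ≤ |f a - f b|)

/-- The span of a labelling: its maximum minus its minimum (on a finite vertex set). -/
noncomputable def span {V : Type*} (f : V → ℤ) : ℤ :=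
  (⨆ x, f x) - (⨅ x, f x)

/-- `λ_{j,k}(Γ)`: the least span of an `L(j,k)`-labelling. The minimum exists on a finite graph, by
`isLeast_lambdaJK` below. -/
noncomputable def lambdaJK {V : Type*} (Γ : SimpleGraph V) (j k : ℕ) : ℤ :=
  sInf {s : ℤ | ∃ f : V → ℤ, IsLabelling Γ j k f ∧ span f = s}

/-- The lambda number `λ(Γ) = λ_{2,1}(Γ)`. -/
noncomputable def lambda {V : Type*} (Γ : SimpleGraph V) : ℤ :=
  lambdaJK Γ 2 1

/-- The power graph of `G`: distinct elements are adjacent when one of them is a positive power of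
the other. -/
def powerGraph (G : Type*) [Group G] : SimpleGraph G where
  Adj a b := a ≠ b ∧ ((∃ n : ℕ, 0 < n ∧ a = b ^ n) ∨ (∃ m : ℕ, 0 < m ∧ b = a ^ m))
  symm := ⟨fun _ _ h => ⟨h.1.symm, h.2.symm⟩⟩
  loopless := ⟨fun _ h => h.1 rfl⟩

/-- `G` is a generalized quaternion `2`-group, of order `2 ^ (e + 1)` with `e ≥ 2`:
`⟨x, y | x ^ (2 ^ e) = 1, x ^ (2 ^ (e - 1)) = y ^ 2, y⁻¹ * x * y = x⁻¹⟩`.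
Mathlib's `QuaternionGroup n` is this group with `2 * n` in place of `2 ^ e`. -/
def IsGeneralizedQuaternion (G : Type*) [Group G] : Prop :=
  ∃ e : ℕ, 2 ≤ e ∧ Nonempty (G ≃* QuaternionGroup (2 ^ (e - 1)))

theorem span_nonneg {V : Type*} [Finite V] (f : V → ℤ) : 0 ≤ span f := by
  unfold span
  rcases isEmpty_or_nonempty V with h | h
  · simp [iSup, iInf, Set.range_eq_empty]
  · obtain ⟨v⟩ := h
    have h1 : f v ≤ ⨆ x, f x := le_ciSup (Set.finite_range f).bddAbove v
    have h2 : ⨅ x, f x ≤ f v := ciInf_le (Set.finite_range f).bddBelow v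
    linarith

theorem exists_isLabelling {V : Type*} [Finite V] (Γ : SimpleGraph V) (j k : ℕ) :
    ∃ f : V → ℤ, IsLabelling Γ j k f := by
  obtain ⟨n, ⟨φ⟩⟩ := Finite.exists_equiv_fin V
  have key : ∀ a b : V, a ≠ b →
      ((j : ℤ) + k) ≤ |((j : ℤ) + k) * (φ a : ℕ) - ((j : ℤ) + k) * (φ b : ℕ)| := by
    intro a b hab
    have h : ((φ a : ℕ) : ℤ) - ((φ b : ℕ) : ℤ) ≠ 0 := by
      intro h0
      apply hab
      apply φ.injective
      apply Fin.ext
      omega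
    rw [← mul_sub, abs_mul, abs_of_nonneg (by positivity : (0 : ℤ) ≤ (j : ℤ) + k)]
    exact le_mul_of_one_le_right (by positivity) (Int.one_le_abs h)
  refine ⟨fun v => ((j : ℤ) + k) * (φ v : ℕ), fun a b h => ?_, fun a b h => ?_⟩
  · have := key a b (by rintro rfl; simp at h)
    simp only
    omega
  · have := key a b (by rintro rfl; simp at h)
    simp only
    omega

/-- On a finite graph `λ_{j,k}(Γ)` really is the minimum of the spans. -/
theorem isLeast_lambdaJK {V : Type*} [Finite V] (Γ : SimpleGraph V) (j k : ℕ) :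
    IsLeast {s : ℤ | ∃ f : V → ℤ, IsLabelling Γ j k f ∧ span f = s} (lambdaJK Γ j k) := by
  have hb : BddBelow {s : ℤ | ∃ f : V → ℤ, IsLabelling Γ j k f ∧ span f = s} :=
    ⟨0, by rintro _ ⟨f, -, rfl⟩; exact span_nonneg f⟩
  obtain ⟨f, hf⟩ := exists_isLabelling Γ j k
  exact ⟨Int.csInf_mem ⟨_, f, hf, rfl⟩ hb, fun s hs => csInf_le hb hs⟩

end LambdaNumber

/-! The identity is adjacent to every other vertex of the power graph, so the diameter is at most 2,
labellings are injective, and both labels next to that of the identity stay unused. This gives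
`card_le_lambda`. When a second vertex is adjacent to all others, one more label is lost
(`card_add_one_le_lambda`). For a cyclic `p`-group the graph is complete and every gap costs a label
(`lambda_of_forall_adj`).

For the upper bounds, the vertices other than the dominating ones are listed so that neighbours in
the list are non-adjacent, and are labelled consecutively. Such a list exists by an exchange
argument (`exists_list_isChain_incomparable`) as soon as each listed `a` has more listed elements
incomparable to it than listed elements in `⟨a⟩`. A translate `g⟨a⟩` supplies them: if `a` is not
central, take `g` not commuting with `a`; if `a` is central, take `g` outside `⟨a⟩` with `g ^ p =
1`.

The second choice fails only if `⟨a⟩` contains every solution of `x ^ p = 1`. By the classical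
theorem on `p`-groups with a unique subgroup of order `p` (`isCyclic_or_isGeneralizedQuaternion`),
the group is then cyclic or generalized quaternion. In the quaternion case the centre consists of
the identity and the involution, which are exactly the two dominating vertices, so the first choice
of `g` suffices for the rest. -/

namespace LambdaNumber
open Subgroup

/-! ### `p`-groups with a unique subgroup of order `p` -/

section UniqueSubgroup

variable {G : Type*} [Group G]

theorem zpow_mul_pow_of_conj {a b : G} {r : ℤ} (hab : b * a * b⁻¹ = a ^ r) (j : ℤ) (n : ℕ) :
    (a ^ j * b) ^ n = a ^ (j * ∑ i ∈ Finset.range n, r ^ i) * b ^ n := by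
  induction n with
  | zero => simp
  | succ n ih =>
    have h : b * a ^ (j * ∑ i ∈ Finset.range n, r ^ i) =
        a ^ (r * (j * ∑ i ∈ Finset.range n, r ^ i)) * b := by
      rw [zpow_mul a r, ← hab, conj_zpow]
      group
    rw [pow_succ', ih, geom_sum_succ, mul_add, mul_one, add_comm, zpow_add, pow_succ' b]
    calc _ = a ^ j * (b * a ^ (j * ∑ i ∈ Finset.range n, r ^ i)) * b ^ n := by group
      _ = _ := by rw [h, mul_left_comm r j]; group

theorem conj_pow_of_conj {a b : G} {r : ℤ} (hab : b * a * b⁻¹ = a ^ r) (n : ℕ) :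
    b ^ n * a * (b ^ n)⁻¹ = a ^ (r ^ n) := by
  induction n with
  | zero => simp
  | succ n ih =>
    calc _ = b * (b ^ n * a * (b ^ n)⁻¹) * b⁻¹ := by rw [pow_succ']; group
      _ = _ := by rw [ih, ← conj_zpow, hab, ← zpow_mul, pow_succ']

variable {p n : ℕ} {a b : G}

/-- The coset `⟨a⟩b` contains a solution of `x ^ p = 1`: with `u` inverse to `s` modulo `p ^ n`, the
`p`-th power of `a ^ (-(u * k)) * b` is `a ^ (-u * k * p * s + p * k) = 1`. By `hroot` that solution
lies in `⟨a⟩`, hence so does `b`. -/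
theorem mem_zpowers_of_conj (ha : orderOf a = p ^ n) (hroot : ∀ x : G, x ^ p = 1 → x ∈ zpowers a)
    {r k s : ℤ} (hab : b * a * b⁻¹ = a ^ r) (hb : b ^ p = a ^ (p * k))
    (hs : ∑ i ∈ Finset.range p, r ^ i = p * s) (hsp : IsCoprime s p) : b ∈ zpowers a := by
  obtain ⟨u, v, huv⟩ := hsp.pow_right (n := n)
  have h : (a ^ (-(u * k)) * b) ^ p = 1 := by
    rw [zpow_mul_pow_of_conj hab, hs, hb, ← zpow_add, ← orderOf_dvd_iff_zpow_eq_one, ha]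
    exact ⟨p * k * v, by push_cast; linear_combination -(p * k : ℤ) * huv⟩
  exact ((zpowers a).mul_mem_cancel_left (zpow_mem (mem_zpowers a) _)).1 (hroot _ h)

theorem mem_zpowers_of_pow_eq (hp : p.Prime) (ha : orderOf a = p ^ n) {m : ℤ} (hb : b ^ p = a ^ m)
    (hm : ¬ (p : ℤ) ∣ m) : a ∈ zpowers b := by
  have hc : IsCoprime m (p ^ n : ℤ) :=
    (((Nat.prime_iff_prime_int.1 hp).coprime_iff_not_dvd.2 hm).symm).pow_right
  obtain ⟨u, v, huv⟩ := hc
  have h : a = (b ^ p) ^ u := by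
    rw [hb, ← zpow_mul, eq_comm]
    nth_rewrite 2 [← zpow_one a]
    rw [zpow_eq_zpow_iff_modEq, ha, Int.modEq_iff_dvd]
    exact ⟨v, by push_cast; linear_combination -huv⟩
  rw [h]
  exact zpow_mem (pow_mem (mem_zpowers b) _) _

/-- Under conjugation the number of fixed points in `N` is divisible by `p`, so there is one besides
the identity; a suitable power of it has order `p`. -/
theorem _root_.IsPGroup.exists_mem_center_orderOf_eq [Finite G] [Fact p.Prime] (hG : IsPGroup p G)
    (N : Subgroup G) [N.Normal] (hN : N ≠ ⊥) : ∃ x ∈ N, x ∈ center G ∧ orderOf x = p := by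
  have hNt : Nontrivial N := (Subgroup.nontrivial_iff_ne_bot N).2 hN
  have hdvd : p ∣ Nat.card N :=
    ((hG.to_subgroup N).card_eq_or_dvd).resolve_left (Finite.one_lt_card (α := N)).ne'
  have hC : IsPGroup p (ConjAct G) := hG.of_equiv ConjAct.toConjAct
  obtain ⟨x, hx, hx1⟩ := hC.exists_fixed_point_of_prime_dvd_card_of_fixed_point N hdvd (a := 1)
    (fun g => smul_one g)
  have hxc : (x : G) ∈ center G := by
    rw [Subgroup.mem_center_iff]
    intro g
    have := congrArg Subtype.val (hx (ConjAct.toConjAct g))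
    rw [ConjAct.Subgroup.val_conj_smul, ConjAct.toConjAct_smul] at this
    rw [← this]
    nth_rewrite 2 [← this]
    group
  obtain ⟨k, hk⟩ := IsPGroup.iff_orderOf.1 hG x
  have hk0 : k ≠ 0 := by
    rintro rfl
    exact hx1 (Subtype.ext (orderOf_eq_one_iff.1 (by simpa using hk)).symm)
  refine ⟨(x : G) ^ p ^ (k - 1), pow_mem x.2 _, pow_mem hxc _, ?_⟩
  rw [orderOf_pow_of_dvd (pow_ne_zero _ (Fact.out : p.Prime).ne_zero)
    (hk ▸ pow_dvd_pow p (Nat.sub_le k 1)), hk, Nat.pow_div (Nat.sub_le k 1)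
    (Fact.out : p.Prime).pos, Nat.sub_sub_self (Nat.one_le_iff_ne_zero.2 hk0), pow_one]

/-- Take `⟨a⟩` of maximal order among normal cyclic subgroups containing `c`. If its centralizer
were larger, the image of the centralizer in `G/⟨a⟩` would contain a central element of order `p`; a
lift `d` either lies in `⟨a⟩` after all, or generates a larger normal cyclic subgroup. -/
theorem exists_normal_zpowers_selfCentralizing [Finite G] [Fact p.Prime] (hG : IsPGroup p G)
    {c : G} (hc : orderOf c = p) (hroot : ∀ x : G, x ^ p = 1 → x ∈ zpowers c) :
    ∃ a : G, (zpowers a).Normal ∧ c ∈ zpowers a ∧ ∀ b : G, b * a = a * b → b ∈ zpowers a := by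
  have hcn : (zpowers c).Normal := by
    refine ⟨fun x hx g => hroot _ ?_⟩
    obtain ⟨k, rfl⟩ := mem_zpowers_iff.1 hx
    rw [conj_pow, ← zpow_natCast, ← zpow_mul, mul_comm, zpow_mul, zpow_natCast, ← hc,
      pow_orderOf_eq_one]
    simp
  obtain ⟨a, ⟨han, hca⟩, hmax⟩ := Set.exists_max_image {a : G | (zpowers a).Normal ∧ c ∈ zpowers a}
    orderOf (Set.toFinite _) ⟨c, hcn, mem_zpowers c⟩
  have hroota : ∀ x : G, x ^ p = 1 → x ∈ zpowers a := fun x hx =>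
    zpowers_le.2 hca (hroot x hx)
  refine ⟨a, han, hca, ?_⟩
  by_contra! ⟨b, hba, hb⟩
  have hmem : ∀ {x : G}, x ∈ centralizer (zpowers a : Set G) ↔ x * a = a * x := by
    intro x
    rw [mem_centralizer_iff]
    constructor
    · intro h
      exact (h a (mem_zpowers a)).symm
    · rintro h _ ⟨k, rfl⟩
      exact ((show Commute x a from h).zpow_right k).symm
  let f := QuotientGroup.mk' (zpowers a)
  have hN : (centralizer (zpowers a : Set G)).map f ≠ ⊥ := by
    intro h
    have hfb : f b ∈ (centralizer (zpowers a : Set G)).map f := mem_map_of_mem f (hmem.2 hba)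
    rw [h, mem_bot] at hfb
    exact hb ((QuotientGroup.eq_one_iff b).1 hfb)
  have hNn : ((centralizer (zpowers a : Set G)).map f).Normal :=
    Subgroup.Normal.map inferInstance f (QuotientGroup.mk'_surjective _)
  obtain ⟨_, ⟨d, hd, rfl⟩, hdc, hdp⟩ :=
    (hG.to_quotient (zpowers a)).exists_mem_center_orderOf_eq _ hN
  have hda : d ∉ zpowers a := by
    intro h
    have : f d = 1 := (QuotientGroup.eq_one_iff d).2 h
    rw [this, orderOf_one] at hdp
    exact (Fact.out : p.Prime).one_lt.ne hdp
  have hdpa : d ^ p ∈ zpowers a := by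
    rw [← QuotientGroup.eq_one_iff]
    change f (d ^ p) = 1
    rw [map_pow, ← hdp, pow_orderOf_eq_one]
  obtain ⟨m, hm⟩ := mem_zpowers_iff.1 hdpa
  obtain ⟨n, hn⟩ := IsPGroup.iff_orderOf.1 hG a
  have hdcomm : d * a = a * d := hmem.1 hd
  by_cases hpm : (p : ℤ) ∣ m
  · obtain ⟨k, rfl⟩ := hpm
    exact hda (mem_zpowers_of_conj (r := 1) (s := 1) hn hroota (by rw [hdcomm]; group) hm.symm
      (by simp) isCoprime_one_left)
  · have had : a ∈ zpowers d := mem_zpowers_of_pow_eq Fact.out hn hm.symm hpm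
    have hle : zpowers a ≤ zpowers d := zpowers_le.2 had
    have hdn : (zpowers d).Normal := by
      refine ⟨?_⟩
      rintro _ ⟨k, rfl⟩ g
      change g * d ^ k * g⁻¹ ∈ _
      rw [← conj_zpow]
      refine zpow_mem ?_ k
      -- Since `d` is central modulo `⟨a⟩`, its conjugates differ from it by elements of `⟨a⟩ ≤
      -- ⟨d⟩`; hence `⟨d⟩` is normal.
      have h : (g * d * g⁻¹) * d⁻¹ ∈ zpowers a := by
        rw [← QuotientGroup.eq_one_iff]
        change f (g * d * g⁻¹ * d⁻¹) = 1
        rw [map_mul, map_mul, map_mul, (Subgroup.mem_center_iff.1 hdc (f g)), map_inv, map_inv]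
        group
      exact ((zpowers d).mul_mem_cancel_right (inv_mem (mem_zpowers d))).1 (hle h)
    have hcard := hmax d ⟨hdn, hle hca⟩
    have : zpowers a = zpowers d := Subgroup.eq_of_le_of_card_ge hle (by simpa using hcard)
    exact hda (this ▸ mem_zpowers d)

/-- For odd `p`, Fermat gives `r ≡ 1` modulo `p`, and then the sum is `p` modulo `p ^ 2`. For `p =
2` the sum is `1 + r`, which is why `r ≡ 1` modulo 4 is needed. -/
theorem geom_sum_eq_prime_mul (hp : p.Prime) {r : ℤ} (hr : (p : ℤ) ∣ r ^ p - 1)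
    (h2 : p = 2 → (4 : ℤ) ∣ r - 1) :
    ∃ s : ℤ, ∑ i ∈ Finset.range p, r ^ i = p * s ∧ IsCoprime s p := by
  rcases hp.eq_two_or_odd' with rfl | hodd
  · obtain ⟨t, ht⟩ := h2 rfl
    refine ⟨1 + 2 * t, ?_, 1, -t, by push_cast; ring⟩
    rw [Finset.sum_range_succ, Finset.sum_range_one]
    push_cast
    linear_combination ht
  · have hr1 : (p : ℤ) ∣ r - 1 := by
      have := Fact.mk hp
      rw [← ZMod.intCast_zmod_eq_zero_iff_dvd] at hr ⊢
      simpa using hr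
    obtain ⟨t, ht⟩ := hr1
    obtain ⟨w, hw⟩ := odd_sq_dvd_geom_sum₂_sub (a := (1 : ℤ)) (b := t) hodd
    obtain rfl : r = 1 + p * t := by linarith
    refine ⟨1 + p * w, ?_, 1, -w, by ring⟩
    simp only [one_pow, mul_one] at hw
    linear_combination hw

/-- Unless `p = 2` and `r ≡ 3` modulo 4, the geometric sum is `p` times a unit and
`mem_zpowers_of_conj` forces `b ∈ ⟨a⟩`. In the remaining case `r - 1` is twice an odd number, and
uniqueness of the involution `c` determines both `b ^ 2` and the action of `b`. -/
theorem conj_eq_inv_of_pow_mem [Finite G] (hp : p.Prime) (ha : orderOf a = p ^ n) {c : G}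
    (hc : orderOf c = p) (hca : c ∈ zpowers a) (hroot : ∀ x : G, x ^ p = 1 → x ∈ zpowers c)
    (hcent : ∀ b : G, b * a = a * b → b ∈ zpowers a) {r m : ℤ} (hab : b * a * b⁻¹ = a ^ r)
    (hb : b ∉ zpowers a) (hbp : b ^ p = a ^ m) :
    p = 2 ∧ b * a * b⁻¹ = a⁻¹ ∧ b ^ 2 = c := by
  have hroota : ∀ x : G, x ^ p = 1 → x ∈ zpowers a := fun x hx =>
    zpowers_le.2 hca (hroot x hx)
  have hpm : (p : ℤ) ∣ m := by
    by_contra h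
    obtain ⟨k, hk⟩ := mem_zpowers_iff.1 (mem_zpowers_of_pow_eq hp ha hbp h)
    exact hb (hcent b (hk ▸ (Commute.refl b).zpow_right k))
  obtain ⟨k, rfl⟩ := hpm
  have hn : n ≠ 0 := by
    rintro rfl
    rw [pow_zero, orderOf_eq_one_iff] at ha
    exact hb (hcent b (by simp [ha]))
  have hconj : a ^ (r ^ p) = a := by
    rw [← conj_pow_of_conj hab, hbp, ((Commute.refl a).zpow_left _).eq]
    group
  have hr : (p : ℤ) ^ n ∣ r ^ p - 1 := by
    have := zpow_eq_zpow_iff_modEq.1 (hconj.trans (zpow_one a).symm)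
    rw [ha, Int.modEq_comm, Int.modEq_iff_dvd] at this
    exact_mod_cast this
  have hnot : ¬ (p = 2 → (4 : ℤ) ∣ r - 1) := by
    intro h
    obtain ⟨s, hs, hsp⟩ := geom_sum_eq_prime_mul hp ((dvd_pow_self _ hn).trans hr) h
    exact hb (mem_zpowers_of_conj ha hroota hab hbp hs hsp)
  push Not at hnot
  obtain ⟨rfl, hr4⟩ := hnot
  have hodd : (2 : ℤ) ∣ r ^ 2 - 1 := by
    simpa using (dvd_pow_self _ hn).trans hr
  have hr3 : ∃ t, r = 3 + 4 * t := by
    rcases Int.even_or_odd r with ⟨t, rfl⟩ | ⟨t, rfl⟩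
    · ring_nf at hodd
      omega
    · rcases Int.even_or_odd t with ⟨t, rfl⟩ | ⟨t, rfl⟩
      · exact absurd ⟨t, by ring⟩ hr4
      · exact ⟨t, by ring⟩
  obtain ⟨t, rfl⟩ := hr3
  have hcop : IsCoprime ((2 : ℤ) ^ n) (1 + 2 * t) := IsCoprime.pow_left ⟨-t, 1, by ring⟩
  have hinv : ∀ x : G, x ^ 2 = 1 → x = 1 ∨ x = c := by
    intro x hx
    obtain ⟨i, rfl⟩ := mem_zpowers_iff.1 (hroot x hx)
    have hc2 : c ^ (2 : ℤ) = 1 := by exact_mod_cast hc ▸ pow_orderOf_eq_one c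
    rcases Int.even_or_odd' i with ⟨j, rfl | rfl⟩
    · left; rw [zpow_mul, hc2, one_zpow]
    · right; rw [zpow_add, zpow_mul, hc2, one_zpow, zpow_one, one_mul]
  -- As `b` commutes with `b ^ 2 = a ^ (2 * k)`, the order of `a` divides `(r - 1) * (2 * k)`; the
  -- odd factor of `r - 1` can be cancelled.
  have hb4 : (b ^ 2) ^ 2 = 1 := by
    have h1 : b * (b ^ 2) * b⁻¹ = b ^ 2 := by group
    rw [hbp, ← conj_zpow, hab, ← zpow_mul, zpow_eq_zpow_iff_modEq, ha, Int.modEq_comm,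
      Int.modEq_iff_dvd] at h1
    rw [hbp, ← zpow_natCast, ← zpow_mul, ← orderOf_dvd_iff_zpow_eq_one, ha]
    push_cast at h1 ⊢
    refine hcop.dvd_of_dvd_mul_left ?_
    rwa [show (1 + 2 * t) * (2 * k * 2) = (3 + 4 * t) * (2 * k) - 2 * k by ring]
  have hb2 : b ^ 2 = c := by
    refine (hinv _ hb4).resolve_left fun h => hb (hroota b h)
  refine ⟨rfl, ?_, hb2⟩
  -- The same cancellation in `r ^ 2 - 1 = (r - 1) * (r + 1)` shows that `a ^ (1 + r)` squares to 1.
  -- It cannot be `c`, for then `(a * b) ^ 2 = a ^ (1 + r) * b ^ 2 = c * c = 1`.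
  have hw2 : (a ^ (1 + (3 + 4 * t))) ^ 2 = 1 := by
    rw [← zpow_natCast, ← zpow_mul, ← orderOf_dvd_iff_zpow_eq_one, ha]
    push_cast at hr ⊢
    refine hcop.dvd_of_dvd_mul_left ?_
    rwa [show (1 + 2 * t) * ((1 + (3 + 4 * t)) * 2) = (3 + 4 * t) ^ 2 - 1 by ring]
  have hw : a ^ (1 + (3 + 4 * t)) = 1 := by
    refine (hinv _ hw2).resolve_right fun h => ?_
    have hab2 : (a ^ (1 : ℤ) * b) ^ 2 = 1 := by
      rw [zpow_mul_pow_of_conj hab, Finset.sum_range_succ, Finset.sum_range_one, pow_zero, pow_one,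
        one_mul, h, hb2, ← sq, ← hc, pow_orderOf_eq_one]
    exact hb (((zpowers a).mul_mem_cancel_left (zpow_mem (mem_zpowers a) _)).1 (hroota _ hab2))
  rw [hab, eq_inv_iff_mul_eq_one, ← hw, ← zpow_add_one, add_comm]

theorem nonempty_mulEquiv_quaternionGroup {N : ℕ} [NeZero N] (ha : orderOf a = 2 * N)
    (hab : b * a * b⁻¹ = a⁻¹) (hb2 : b ^ 2 = a ^ N) (hb : b ∉ zpowers a)
    (hcov : ∀ g : G, g ∉ zpowers a → g * b⁻¹ ∈ zpowers a) :
    Nonempty (G ≃* QuaternionGroup N) := by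
  let E : ZMod (2 * N) → G := fun i => a ^ i.val
  have hadd : ∀ i j, E (i + j) = E i * E j := fun i j => by
    simp only [E]
    rw [ZMod.val_add, ← pow_add, ← pow_mod_orderOf a (i.val + j.val), ha]
  have hsub : ∀ i j, E (j - i) = (E i)⁻¹ * E j := fun i j => by
    rw [eq_inv_mul_iff_mul_eq, ← hadd, add_sub_cancel]
  have hN : E N = a ^ N := by
    simp only [E]
    rw [ZMod.val_natCast, ← pow_mod_orderOf a N, ha]
  have hcomm : ∀ i, E i * b = b * (E i)⁻¹ := fun i => by
    have : b * (E i)⁻¹ * b⁻¹ = E i := by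
      simp only [E]
      rw [← inv_pow, ← conj_pow, ← conj_inv, hab, inv_inv]
    exact (mul_inv_eq_iff_eq_mul.1 this).symm
  have hmemE : ∀ i, E i ∈ zpowers a := fun i => pow_mem (mem_zpowers a) _
  have hEmem : ∀ g ∈ zpowers a, ∃ i, E i = g := by
    intro g hg
    obtain ⟨k, rfl⟩ := mem_zpowers_iff.1 hg
    refine ⟨(k : ZMod (2 * N)), ?_⟩
    simp only [E]
    rw [← zpow_natCast, zpow_eq_zpow_iff_modEq, ha, ← ZMod.intCast_eq_intCast_iff]
    simp
  have hEinj : Function.Injective E := by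
    intro i j hij
    have := pow_injOn_Iio_orderOf (x := a) (by rw [ha]; exact ZMod.val_lt i)
      (by rw [ha]; exact ZMod.val_lt j) hij
    exact ZMod.val_injective _ this
  let φ : QuaternionGroup N → G := fun
    | .a i => E i
    | .xa i => b * E i
  have hmul : ∀ x y, φ (x * y) = φ x * φ y := by
    rintro (i | i) (j | j)
    · exact hadd i j
    · change b * E (j - i) = E i * (b * E j)
      rw [← mul_assoc, hcomm, hsub, mul_assoc]
    · change b * E (i + j) = b * E i * E j
      rw [hadd, mul_assoc]
    · change E (N + j - i) = b * E i * (b * E j)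
      rw [add_sub_assoc, hadd, hN, hsub, ← hb2, mul_assoc b, ← mul_assoc (E i), hcomm, sq]
      simp only [mul_assoc]
  have hbE : ∀ i j, E i ≠ b * E j := fun i j h =>
    hb (((zpowers a).mul_mem_cancel_right (hmemE j)).1 (h ▸ hmemE i))
  have hinj : Function.Injective φ := by
    rintro (i | i) (j | j) h
    · exact congrArg _ (hEinj h)
    · exact absurd h (hbE i j)
    · exact absurd h.symm (hbE j i)
    · exact congrArg _ (hEinj (mul_left_cancel h))
  have hsurj : Function.Surjective φ := by
    intro g
    by_cases hg : g ∈ zpowers a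
    · obtain ⟨i, hi⟩ := hEmem g hg
      exact ⟨.a i, hi⟩
    · obtain ⟨i, hi⟩ := hEmem _ (hcov g hg)
      obtain ⟨j, hj⟩ := hEmem _ (inv_mem (hmemE i))
      refine ⟨.xa j, ?_⟩
      change b * E j = g
      rw [hj, ← hcomm, hi, inv_mul_cancel_right]
  exact ⟨(MulEquiv.ofBijective (MonoidHom.mk' φ hmul) ⟨hinj, hsurj⟩).symm⟩

/-- Every element outside the self-centralizing normal subgroup `⟨a⟩` inverts `a` and squares to
`c`. Two such elements differ by something centralizing `a`, so `⟨a⟩` has index at most 2. -/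
theorem isCyclic_or_isGeneralizedQuaternion [Finite G] (hp : p.Prime) (hG : IsPGroup p G)
    {c : G} (hc : orderOf c = p) (hroot : ∀ x : G, x ^ p = 1 → x ∈ zpowers c) :
    IsCyclic G ∨ IsGeneralizedQuaternion G := by
  have := Fact.mk hp
  obtain ⟨a, han, hca, hcent⟩ := exists_normal_zpowers_selfCentralizing hG hc hroot
  by_cases hall : ∀ g : G, g ∈ zpowers a
  · exact .inl ⟨a, hall⟩
  right
  obtain ⟨n, ha⟩ := IsPGroup.iff_orderOf.1 hG a
  have key : ∀ g : G, g ∉ zpowers a → p = 2 ∧ 2 ≤ n ∧ g * a * g⁻¹ = a⁻¹ ∧ g ^ 2 = c := by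
    intro g hg
    obtain ⟨s, hs⟩ := mem_zpowers_iff.1 (han.conj_mem a (mem_zpowers a) g)
    -- The last iterated `p`-th power of `g` still outside `⟨a⟩` has its `p`-th power inside, as
    -- `conj_eq_inv_of_pow_mem` requires.
    have hex : ∃ k, g ^ p ^ k ∈ zpowers a := by
      obtain ⟨k, hk⟩ := hG g
      exact ⟨k, hk ▸ one_mem _⟩
    classical
    obtain ⟨m, hm⟩ : ∃ m, Nat.find hex = m + 1 := by
      refine Nat.exists_eq_succ_of_ne_zero fun h0 => hg ?_
      have := Nat.find_spec hex
      rwa [h0, pow_zero, pow_one] at this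
    have hbA : g ^ p ^ m ∉ zpowers a := Nat.find_min hex (by omega)
    have hbp : (g ^ p ^ m) ^ p ∈ zpowers a := by
      rw [← pow_mul, ← pow_succ, ← hm]
      exact Nat.find_spec hex
    obtain ⟨l, hl⟩ := mem_zpowers_iff.1 hbp
    obtain ⟨rfl, hinv, hsq⟩ := conj_eq_inv_of_pow_mem hp ha hc hca hroot hcent
      (conj_pow_of_conj hs.symm _) hbA hl.symm
    have hn : 2 ≤ n := by
      by_contra h
      refine hbA (hcent _ ?_)
      have h2 : a ^ 2 = 1 := by
        rw [← orderOf_dvd_iff_pow_eq_one, ha]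
        exact (pow_dvd_pow 2 (show n ≤ 1 by omega)).trans (by simp)
      rw [mul_inv_eq_iff_eq_mul] at hinv
      rw [hinv, inv_eq_of_mul_eq_one_right (by rw [← sq, h2])]
    -- That power must be `g` itself: otherwise `a` is conjugated to `a` raised to a square, and -1
    -- is not a square modulo 4.
    obtain rfl : m = 0 := by
      by_contra hm0
      obtain ⟨m, rfl⟩ := Nat.exists_eq_succ_of_ne_zero hm0
      have h := (conj_pow_of_conj hs.symm (2 ^ (m + 1))).symm.trans hinv
      rw [← zpow_neg_one, zpow_eq_zpow_iff_modEq, ha, Int.modEq_comm, Int.modEq_iff_dvd] at h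
      have h4 : (4 : ℤ) ∣ s ^ 2 ^ (m + 1) - -1 := by
        refine dvd_trans ?_ h
        exact_mod_cast pow_dvd_pow 2 hn
      rw [pow_succ, pow_mul] at h4
      generalize s ^ 2 ^ m = u at h4
      rcases Int.even_or_odd' u with ⟨v, rfl | rfl⟩
      · ring_nf at h4; omega
      · ring_nf at h4; omega
    rw [pow_zero, pow_one] at hinv hsq
    exact ⟨rfl, hn, hinv, hsq⟩
  push Not at hall
  obtain ⟨b, hb⟩ := hall
  obtain ⟨rfl, hn, hinv, hsq⟩ := key b hb
  have h2n : 2 * 2 ^ (n - 1) = 2 ^ n := by rw [← pow_succ', Nat.sub_add_cancel (by omega)]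
  refine ⟨n, hn, nonempty_mulEquiv_quaternionGroup (ha.trans h2n.symm) hinv ?_ hb ?_⟩
  · have h1 : orderOf (a ^ 2 ^ (n - 1)) = 2 := by
      rw [orderOf_pow_of_dvd (by positivity) (ha ▸ ⟨2, by rw [mul_comm, h2n]⟩), ha, ← h2n]
      exact Nat.mul_div_left _ (by positivity)
    obtain ⟨i, hi⟩ := mem_zpowers_iff.1 (hroot _ (h1 ▸ pow_orderOf_eq_one (a ^ 2 ^ (n - 1))))
    have hc2 : c ^ (2 : ℤ) = 1 := by exact_mod_cast hc ▸ pow_orderOf_eq_one c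
    rcases Int.even_or_odd' i with ⟨j, rfl | rfl⟩
    · rw [zpow_mul, hc2, one_zpow] at hi
      rw [← hi, orderOf_one] at h1
      omega
    · rw [zpow_add, zpow_mul, hc2, one_zpow, zpow_one, one_mul] at hi
      rw [hsq, hi]
  · intro g hg
    refine hcent _ ?_
    obtain ⟨-, -, hgi, -⟩ := key g hg
    have h1 : b⁻¹ * a * b = a⁻¹ := by
      have : b⁻¹ * (b * a * b⁻¹) * b = a := by group
      rw [hinv] at this
      calc _ = (b⁻¹ * a⁻¹ * b)⁻¹ := by group
        _ = _ := by rw [this]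
    calc g * b⁻¹ * a = g * (b⁻¹ * a * b) * g⁻¹ * (g * b⁻¹) := by group
      _ = (g * a * g⁻¹)⁻¹ * (g * b⁻¹) := by rw [h1]; group
      _ = _ := by rw [hgi, inv_inv]

end UniqueSubgroup

/-! ### Listing a finite set with consecutive entries incomparable -/

section Arrangement

variable {α : Type*}

open Classical in
/-- The number of consecutive entries of a list that are related by `R`. -/
noncomputable def relCount (R : α → α → Prop) : List α → ℕ
  | [] => 0
  | [_] => 0
  | a :: b :: l => (if R a b then 1 else 0) + relCount R (b :: l)

open Classical in
theorem relCount_append (R : α → α → Prop) (l₁ l₂ : List α) (a b : α) :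
    relCount R (l₁ ++ a :: b :: l₂) =
      relCount R (l₁ ++ [a]) + (if R a b then 1 else 0) + relCount R (b :: l₂) := by
  induction l₁ with
  | nil => simp [relCount]
  | cons c l ih =>
    cases l with
    | nil => simp [relCount, add_assoc]
    | cons d l =>
      simp only [List.cons_append, relCount] at ih ⊢
      rw [ih]; ring

open Classical in
theorem relCount_reverse {R : α → α → Prop} (hR : ∀ a b, R a b → R b a) (l : List α) :
    relCount R l.reverse = relCount R l := by
  induction l with
  | nil => rfl
  | cons a l ih =>
    cases l with
    | nil => rfl
    | cons b l =>
      have h : (a :: b :: l).reverse = l.reverse ++ b :: a :: [] := by simp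
      have hab : R b a ↔ R a b := ⟨hR b a, hR a b⟩
      rw [h, relCount_append, ← List.reverse_cons, ih]
      simp only [relCount, hab]
      ring

theorem isChain_of_relCount_eq_zero {R : α → α → Prop} {l : List α} (h : relCount R l = 0) :
    l.IsChain (fun a b => ¬ R a b) := by
  induction l with
  | nil => simp
  | cons a l ih =>
    cases l with
    | nil => simp
    | cons b l =>
      simp only [relCount, Nat.add_eq_zero_iff, ite_eq_right_iff, one_ne_zero, imp_false] at h
      exact List.isChain_cons_cons.2 ⟨h.1, ih h.2⟩

theorem exists_rel_of_relCount_ne_zero {R : α → α → Prop} {l : List α} (h : relCount R l ≠ 0) :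
    ∃ l₁ l₂ a b, R a b ∧ l = l₁ ++ a :: b :: l₂ := by
  induction l with
  | nil => exact absurd rfl h
  | cons a l ih =>
    cases l with
    | nil => exact absurd rfl h
    | cons b l =>
      by_cases hab : R a b
      · exact ⟨[], l, a, b, hab, rfl⟩
      · obtain ⟨l₁, l₂, c, d, hcd, hl⟩ := ih (by simpa [relCount, hab] using h)
        exact ⟨a :: l₁, l₂, c, d, hcd, by rw [hl]; rfl⟩

-- Reversing the segment from `b` to `u` changes only its two boundary pairs, since `R` is
-- symmetric.
open Classical in
theorem relCount_reverse_segment {R : α → α → Prop} (hR : ∀ a b, R a b → R b a)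
    (l₁ m l₂ : List α) (a b u v : α) :
    relCount R (l₁ ++ a :: b :: (m ++ u :: v :: l₂)) + (if R a u then 1 else 0) +
        (if R b v then 1 else 0) =
      relCount R (l₁ ++ a :: u :: (m.reverse ++ b :: v :: l₂)) + (if R a b then 1 else 0) +
        (if R u v then 1 else 0) := by
  have h : relCount R (u :: m.reverse ++ [b]) = relCount R (b :: m ++ [u]) := by
    rw [← relCount_reverse hR (b :: m ++ [u])]; simp
  have h1 := relCount_append R (b :: m) l₂ u v
  have h2 := relCount_append R (u :: m.reverse) l₂ b v
  rw [List.cons_append] at h1 h2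
  rw [relCount_append, relCount_append, h1, h2, h]
  ring

open Classical in
theorem relCount_reverse_tail {R : α → α → Prop} (hR : ∀ a b, R a b → R b a)
    (l₁ m : List α) (a b u : α) :
    relCount R (l₁ ++ a :: b :: (m ++ [u])) + (if R a u then 1 else 0) =
      relCount R (l₁ ++ a :: u :: (m.reverse ++ [b])) + (if R a b then 1 else 0) := by
  have h : relCount R (u :: m.reverse ++ [b]) = relCount R (b :: m ++ [u]) := by
    rw [← relCount_reverse hR (b :: m ++ [u])]; simp
  rw [List.cons_append, List.cons_append] at h
  rw [relCount_append, relCount_append, h]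
  ring

/-- A finite set carrying a forest-like preorder can be listed with consecutive entries
incomparable, provided every element has more incomparable elements than lower bounds. -/
theorem exists_list_isChain_incomparable [DecidableEq α] (S : Finset α) (le : α → α → Prop)
    (h : α → ℕ) (hrefl : ∀ a, le a a) (hmono : ∀ a b, le a b → h a ≤ h b)
    (hforest : ∀ a b c, le a c → le b c → h a ≤ h b → le a b)
    (hcard : ∀ a ∈ S, Set.ncard {x | x ∈ S ∧ le x a} <
      Set.ncard {x | x ∈ S ∧ ¬ le x a ∧ ¬ le a x}) :
    ∃ l : List α, l.Nodup ∧ l.toFinset = S ∧ l.IsChain (fun a b => ¬ (le a b ∨ le b a)) := by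
  classical
  set R : α → α → Prop := fun a b => le a b ∨ le b a with hRdef
  have hR : ∀ a b, R a b → R b a := fun a b => Or.symm
  let P : ℕ → Prop := fun k => ∃ l : List α, l.Nodup ∧ l.toFinset = S ∧ relCount R l = k
  have hP : ∃ k, P k := ⟨_, S.toList, S.nodup_toList, S.toList_toFinset, rfl⟩
  by_cases h0 : P 0
  · obtain ⟨l, hl, hlS, hl0⟩ := h0
    exact ⟨l, hl, hlS, isChain_of_relCount_eq_zero hl0⟩
  exfalso
  let k := Nat.find hP
  have hk0 : k ≠ 0 := fun hk => h0 (hk ▸ Nat.find_spec hP)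
  have hmin : ∀ l : List α, l.Nodup → l.toFinset = S → k ≤ relCount R l := fun l h1 h2 =>
    Nat.find_min' hP ⟨l, h1, h2, rfl⟩
  obtain ⟨l₀, hl₀, hl₀S, hl₀k⟩ : P k := Nat.find_spec hP
  have hmin' : ∀ l : List α, l.Perm l₀ → k ≤ relCount R l := fun l hl =>
    hmin l (hl.nodup_iff.2 hl₀) (by rw [List.toFinset_eq_of_perm _ _ hl, hl₀S])
  -- `B` collects the bad pairs of all arrangements attaining the minimum `k`. The pair studied
  -- below maximizes the sum of heights over all of `B`, so it also bounds the bad pairs created by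
  -- an exchange.
  let B : Finset (α × α) := (S ×ˢ S).filter fun q => R q.1 q.2 ∧
    ∃ l₁ l₂, (l₁ ++ q.1 :: q.2 :: l₂).Perm l₀ ∧ relCount R (l₁ ++ q.1 :: q.2 :: l₂) = k
  have hmemS : ∀ {l : List α} {x : α}, l.Perm l₀ → (x ∈ l ↔ x ∈ S) := fun {l x} hl => by
    rw [hl.mem_iff, ← hl₀S, List.mem_toFinset]
  have hBmem : ∀ {l₁ l₂ : List α} {a b : α}, R a b → (l₁ ++ a :: b :: l₂).Perm l₀ →
      relCount R (l₁ ++ a :: b :: l₂) = k → (a, b) ∈ B := by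
    intro l₁ l₂ a b hab hp hk
    simp only [B, Finset.mem_filter, Finset.mem_product]
    exact ⟨⟨(hmemS hp).1 (by simp), (hmemS hp).1 (by simp)⟩, hab, l₁, l₂, hp, hk⟩
  have hBne : B.Nonempty := by
    obtain ⟨l₁, l₂, a, b, hab, rfl⟩ := exists_rel_of_relCount_ne_zero (hl₀k ▸ hk0)
    exact ⟨(a, b), hBmem hab (List.Perm.refl _) hl₀k⟩
  obtain ⟨⟨a', b'⟩, hq, hqmax⟩ := B.exists_max_image (fun q => h q.1 + h q.2) hBne
  obtain ⟨l₁, l₂, a, b, hab, hp, hk, hmax⟩ : ∃ l₁ l₂ a b, le a b ∧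
      (l₁ ++ a :: b :: l₂).Perm l₀ ∧ relCount R (l₁ ++ a :: b :: l₂) = k ∧
      ∀ q ∈ B, h q.1 + h q.2 ≤ h a + h b := by
    simp only [B, Finset.mem_filter] at hq
    obtain ⟨-, hR', l₁, l₂, hp, hk⟩ := hq
    rcases hR' with hab | hab
    · exact ⟨l₁, l₂, a', b', hab, hp, hk, hqmax⟩
    · have hrev : (l₁ ++ a' :: b' :: l₂).reverse = l₂.reverse ++ b' :: a' :: l₁.reverse := by simp
      refine ⟨l₂.reverse, l₁.reverse, b', a', hab, ?_, ?_, fun q hq => ?_⟩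
      · rw [← hrev]; exact (List.reverse_perm _).trans hp
      · rw [← hrev, relCount_reverse hR, hk]
      · rw [add_comm (h b')]; exact hqmax q hq
  have hRab : R a b := .inl hab
  have haS : a ∈ S := (hmemS hp).1 (by simp)
  have hnd : (l₁ ++ a :: b :: l₂).Nodup := hp.nodup_iff.2 hl₀
  -- a new bad pair `(b, v)` has `v ≤ a`
  have hdown : ∀ v, R b v → ((b, v) ∈ B ∨ (v, b) ∈ B) → le v a := by
    intro v hbv hB
    have hle : h v + h b ≤ h a + h b := by
      rcases hB with hB | hB
      · rw [add_comm (h v)]; exact hmax _ hB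
      · exact hmax _ hB
    have hva : h v ≤ h a := by omega
    have hvb : le v b := by
      rcases hbv with hbv | hbv
      · exact hforest v b v (hrefl v) hbv (hva.trans (hmono a b hab))
      · exact hbv
    exact hforest v a b hvb hab hva
  have hInc : ∀ u, ¬ le u a → ¬ le a u → ¬ R a u := fun u h1 h2 h3 => h3.elim h2 h1
  -- If `u` is incomparable to `a` and `v` follows `u`, a reversal replaces the pairs `ab`, `uv` by
  -- `au`, `bv`. This removes the bad pair `ab`, so minimality makes `bv` bad and the new
  -- arrangement again minimal; `hdown` then gives `le v a`.
  have hsucc : ∀ u ∈ S, ¬ le u a → ¬ le a u →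
      ∃ v ∈ S, le v a ∧ ∃ m₁ m₂, l₁ ++ a :: b :: l₂ = m₁ ++ u :: v :: m₂ := by
    intro u hu hua hau
    have hRau := hInc u hua hau
    have hub : u ≠ b := fun e => hau (e ▸ hab)
    have hua' : u ≠ a := fun e => hua (e ▸ hrefl u)
    have hul : u ∈ l₁ ∨ u ∈ l₂ := by
      have := (hmemS hp).2 hu
      simpa [hub, hua'] using this
    rcases hul with hul | hul
    · obtain ⟨m₁, m₂, rfl⟩ := List.append_of_mem hul
      cases m₂ with
      | nil => exact ⟨a, haS, hrefl a, m₁, b :: l₂, by simp⟩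
      | cons v m₂ =>
        have heq : m₁ ++ u :: v :: m₂ ++ a :: b :: l₂ = m₁ ++ u :: v :: (m₂ ++ a :: b :: l₂) := by
          simp
        have hperm : (m₁ ++ u :: a :: (m₂.reverse ++ v :: b :: l₂)).Perm l₀ := by
          refine List.Perm.trans ?_ hp
          rw [heq]
          refine List.Perm.append_left _ (List.Perm.cons _ ?_)
          have : (a :: (m₂.reverse ++ v :: b :: l₂)) = (v :: (m₂ ++ [a])).reverse ++ b :: l₂ := by
            simp
          rw [this]
          refine ((List.reverse_perm _).append_right _).trans ?_
          simp
        have hc := relCount_reverse_segment hR m₁ m₂ l₂ u v a b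
        rw [← heq, hk] at hc
        have h1 := hmin' _ hperm
        have hRua : ¬ R u a := fun e => hRau (hR _ _ e)
        rw [if_neg hRua, if_pos hRab] at hc
        have hvb : R v b := by
          by_contra hvb
          rw [if_neg hvb] at hc
          omega
        rw [if_pos hvb] at hc
        have hperm' : ((m₁ ++ u :: a :: m₂.reverse) ++ v :: b :: l₂).Perm l₀ := by
          simpa using hperm
        refine ⟨v, (hmemS hp).1 (by simp), hdown v (hR _ _ hvb) (.inr (hBmem hvb hperm' ?_)),
          m₁, m₂ ++ a :: b :: l₂, heq⟩
        have : (m₁ ++ u :: a :: m₂.reverse) ++ v :: b :: l₂ =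
          m₁ ++ u :: a :: (m₂.reverse ++ v :: b :: l₂) := by simp
        rw [this]
        omega
    · obtain ⟨m₁, m₂, rfl⟩ := List.append_of_mem hul
      cases m₂ with
      -- If `u` came last, reversing the tail would remove `ab` without creating a bad pair.
      | nil =>
        exfalso
        have hperm : (l₁ ++ a :: u :: (m₁.reverse ++ [b])).Perm l₀ := by
          refine List.Perm.trans ?_ hp
          refine List.Perm.append_left _ (List.Perm.cons _ ?_)
          have : (u :: (m₁.reverse ++ [b])) = (b :: (m₁ ++ [u])).reverse := by simp
          rw [this]
          exact List.reverse_perm _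
        have hc := relCount_reverse_tail hR l₁ m₁ a b u
        have h1 := hmin' _ hperm
        rw [hk, if_neg hRau, if_pos hRab] at hc
        omega
      | cons v m₂ =>
        have hperm : (l₁ ++ a :: u :: (m₁.reverse ++ b :: v :: m₂)).Perm l₀ := by
          refine List.Perm.trans ?_ hp
          refine List.Perm.append_left _ (List.Perm.cons _ ?_)
          have : (u :: (m₁.reverse ++ b :: v :: m₂)) = (b :: (m₁ ++ [u])).reverse ++ v :: m₂ := by
            simp
          rw [this]
          refine ((List.reverse_perm _).append_right _).trans ?_
          simp
        have hc := relCount_reverse_segment hR l₁ m₁ m₂ a b u v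
        have h1 := hmin' _ hperm
        rw [hk, if_neg hRau, if_pos hRab] at hc
        have hbv : R b v := by
          by_contra hbv
          rw [if_neg hbv] at hc
          omega
        rw [if_pos hbv] at hc
        have hperm' : ((l₁ ++ a :: u :: m₁.reverse) ++ b :: v :: m₂).Perm l₀ := by
          simpa using hperm
        refine ⟨v, (hmemS hp).1 (by simp), hdown v hbv (.inl (hBmem hbv hperm' ?_)),
          l₁ ++ a :: b :: m₁, m₂, by simp⟩
        have : (l₁ ++ a :: u :: m₁.reverse) ++ b :: v :: m₂ =
          l₁ ++ a :: u :: (m₁.reverse ++ b :: v :: m₂) := by simp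
        rw [this]
        omega
  -- Taking successors injects the elements incomparable to `a` into the lower bounds of `a`,
  -- against `hcard`.
  refine absurd (hcard a haS) (not_lt.2 ?_)
  choose! f hfS hfa hf using hsucc
  refine Set.ncard_le_ncard_of_injOn f (fun u hu => ⟨hfS u hu.1 hu.2.1 hu.2.2,
    hfa u hu.1 hu.2.1 hu.2.2⟩) ?_ (S.finite_toSet.subset fun x hx => hx.1)
  intro u hu w hw huw
  obtain ⟨m₁, m₂, h1⟩ := hf u hu.1 hu.2.1 hu.2.2
  obtain ⟨n₁, n₂, h2⟩ := hf w hw.1 hw.2.1 hw.2.2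
  have hnd1 := h1 ▸ hnd
  rw [← huw] at h2
  have h3 : (m₁ ++ [u]) ++ f u :: m₂ = (n₁ ++ [w]) ++ f u :: n₂ := by
    simpa using h1.symm.trans h2
  have h4 : m₁ ++ [u] = n₁ ++ [w] := by
    have hx : f u ∉ m₁ ++ [u] := by
      intro hx
      have : ((m₁ ++ [u]) ++ f u :: m₂).Nodup := by simpa using hnd1
      exact (List.nodup_append.1 this).2.2 _ hx _ (by simp) rfl
    have hy : f u ∉ n₁ ++ [w] := by
      intro hy
      have : ((n₁ ++ [w]) ++ f u :: n₂).Nodup := by rw [← h3]; simpa using hnd1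
      exact (List.nodup_append.1 this).2.2 _ hy _ (by simp) rfl
    have e1 := List.idxOf_append_of_notMem (l₂ := f u :: m₂) hx
    have e2 := List.idxOf_append_of_notMem (l₂ := f u :: n₂) hy
    rw [h3, e2] at e1
    exact (List.append_inj h3 (by simpa using e1.symm)).1
  simpa using List.append_inj_right' h4 rfl

end Arrangement

/-! ### Bounds for the lambda number of a power graph -/

section Labelling

variable {G : Type*} [Group G] [Finite G]

theorem powerGraph_adj_iff {a b : G} :
    (powerGraph G).Adj a b ↔ a ≠ b ∧ (a ∈ zpowers b ∨ b ∈ zpowers a) := by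
  have key : ∀ a b : G, (∃ n : ℕ, 0 < n ∧ a = b ^ n) ↔ a ∈ zpowers b := by
    intro a b
    constructor
    · rintro ⟨n, -, rfl⟩
      exact pow_mem (mem_zpowers b) n
    · intro h
      obtain ⟨n, rfl⟩ := mem_powers_iff_mem_zpowers.2 h
      exact ⟨n + orderOf b, by have := orderOf_pos b; omega, by
        simp [pow_add, pow_orderOf_eq_one]⟩
  change a ≠ b ∧ ((∃ n : ℕ, 0 < n ∧ a = b ^ n) ∨ (∃ m : ℕ, 0 < m ∧ b = a ^ m)) ↔ _
  rw [key, key]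

/-- Any two vertices are joined by a path through the identity, so distinct non-adjacent ones are at
distance exactly 2. -/
theorem isLabelling_powerGraph_iff {f : G → ℤ} : IsLabelling (powerGraph G) 2 1 f ↔
    (∀ a b, (powerGraph G).Adj a b → 2 ≤ |f a - f b|) ∧ ∀ a b, a ≠ b → 1 ≤ |f a - f b| := by
  constructor
  · rintro ⟨h1, h2⟩
    have hadj : ∀ a b, (powerGraph G).Adj a b → 2 ≤ |f a - f b| := fun a b hab => by
      exact_mod_cast h1 a b (SimpleGraph.dist_eq_one_iff_adj.2 hab)
    refine ⟨hadj, fun a b hab => ?_⟩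
    by_cases h : (powerGraph G).Adj a b
    · have := hadj a b h; omega
    · have h1a : ∀ x : G, x ≠ 1 → (powerGraph G).Adj x 1 := fun x hx =>
        powerGraph_adj_iff.2 ⟨hx, .inr (one_mem _)⟩
      have ha : a ≠ 1 := by
        rintro rfl
        exact h (h1a b hab.symm).symm
      have hb : b ≠ 1 := by
        rintro rfl
        exact h (h1a a hab)
      let w : (powerGraph G).Walk a b := .cons (h1a a ha) (.cons (h1a b hb).symm .nil)
      have hle : (powerGraph G).dist a b ≤ 2 := SimpleGraph.dist_le w
      have hlt := SimpleGraph.Reachable.one_lt_dist_of_ne_of_not_adj ⟨w⟩ hab h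
      exact_mod_cast h2 a b (by omega)
  · rintro ⟨h1, h2⟩
    refine ⟨fun a b hab => ?_, fun a b hab => ?_⟩
    · exact_mod_cast h1 a b (SimpleGraph.dist_eq_one_iff_adj.1 hab)
    · exact_mod_cast h2 a b (by rintro rfl; simp at hab)

theorem lambda_le {V : Type*} [Finite V] [Nonempty V] {Γ : SimpleGraph V} {f : V → ℤ}
    (hf : IsLabelling Γ 2 1 f) {B : ℤ} (h0 : ∀ x, 0 ≤ f x) (hB : ∀ x, f x ≤ B) : lambda Γ ≤ B := by
  refine ((isLeast_lambdaJK Γ 2 1).2 ⟨f, hf, rfl⟩).trans ?_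
  have h1 : ⨆ x, f x ≤ B := ciSup_le hB
  have h2 : 0 ≤ ⨅ x, f x := le_ciInf h0
  unfold span
  omega

theorem le_lambda {V : Type*} [Finite V] {Γ : SimpleGraph V} {B : ℤ}
    (h : ∀ f : V → ℤ, IsLabelling Γ 2 1 f → B ≤ span f) : B ≤ lambda Γ := by
  obtain ⟨f, hf, hs⟩ := (isLeast_lambdaJK Γ 2 1).1
  exact (h f hf).trans_eq hs

/-- The labels that a labelling leaves unused lengthen its span. -/
theorem card_add_card_le {V : Type*} [Finite V] {f : V → ℤ} (hf : Function.Injective f)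
    {T : Finset ℤ} (hT : ∀ t ∈ T, (∀ x, f x ≠ t) ∧ (∃ x, f x ≤ t) ∧ ∃ x, t ≤ f x) [Nonempty V] :
    (Nat.card V : ℤ) + T.card ≤ span f + 1 := by
  classical
  have := Fintype.ofFinite V
  have hb : ∀ x, (⨅ x, f x) ≤ f x ∧ f x ≤ ⨆ x, f x := fun x =>
    ⟨ciInf_le (Set.finite_range f).bddBelow x, le_ciSup (Set.finite_range f).bddAbove x⟩
  have hsub : Finset.univ.image f ∪ T ⊆ Finset.Icc (⨅ x, f x) (⨆ x, f x) := by
    intro t ht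
    rw [Finset.mem_Icc]
    rcases Finset.mem_union.1 ht with ht | ht
    · obtain ⟨x, -, rfl⟩ := Finset.mem_image.1 ht
      exact hb x
    · obtain ⟨-, ⟨x, hx⟩, y, hy⟩ := hT t ht
      exact ⟨(hb x).1.trans hx, hy.trans (hb y).2⟩
  have hdisj : Disjoint (Finset.univ.image f) T := by
    rw [Finset.disjoint_left]
    intro t ht htT
    obtain ⟨x, -, hx⟩ := Finset.mem_image.1 ht
    exact (hT t htT).1 x hx
  have hcard := Finset.card_le_card hsub
  rw [Finset.card_union_of_disjoint hdisj, Finset.card_image_of_injective _ hf, Int.card_Icc,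
    Finset.card_univ, ← Nat.card_eq_fintype_card] at hcard
  have := span_nonneg f
  unfold span at this ⊢
  omega

theorem injective_of_isLabelling {f : G → ℤ} (hf : IsLabelling (powerGraph G) 2 1 f) :
    Function.Injective f := by
  intro a b hab
  by_contra hne
  have := (isLabelling_powerGraph_iff.1 hf).2 a b hne
  simp [hab] at this

theorem card_le_lambda [Nontrivial G] : (Nat.card G : ℤ) ≤ lambda (powerGraph G) := by
  refine le_lambda fun f hf => ?_
  have hinj := injective_of_isLabelling hf
  have h2 : ∀ x : G, x ≠ 1 → 2 ≤ f x - f 1 ∨ 2 ≤ -(f x - f 1) := fun x hx =>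
    le_abs.1 ((isLabelling_powerGraph_iff.1 hf).1 x 1
      (powerGraph_adj_iff.2 ⟨hx, .inr (one_mem _)⟩))
  have hunused : ∀ x, f x ≠ f 1 + 1 ∧ f x ≠ f 1 - 1 := by
    intro x
    by_cases hx : x = 1
    · subst hx; omega
    · have := h2 x hx; omega
  obtain ⟨x, hx⟩ := exists_ne (1 : G)
  rcases h2 x hx with h | h
  · have := card_add_card_le hinj (T := {f 1 + 1}) (by
      simp only [Finset.mem_singleton, forall_eq]
      exact ⟨fun y => (hunused y).1, ⟨1, by omega⟩, x, by omega⟩)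
    simp only [Finset.card_singleton] at this
    push_cast at this
    omega
  · have := card_add_card_le hinj (T := {f 1 - 1}) (by
      simp only [Finset.mem_singleton, forall_eq]
      exact ⟨fun y => (hunused y).2, ⟨x, by omega⟩, 1, by omega⟩)
    simp only [Finset.card_singleton] at this
    push_cast at this
    omega

/-- Both `1` and `z` are adjacent to everything, so the labels beside theirs are unused. Two
distinct ones lie within the range: the only danger is that `1` and `z` are extremal and share the
gap between them, but then `w` lies in between and separates their inner gaps. -/
theorem card_add_one_le_lambda {z w : G} (hz1 : z ≠ 1) (hw1 : w ≠ 1) (hwz : w ≠ z)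
    (hz : ∀ x : G, x ≠ 1 → z ∈ zpowers x) : (Nat.card G : ℤ) + 1 ≤ lambda (powerGraph G) := by
  refine le_lambda fun f hf => ?_
  have hinj := injective_of_isLabelling hf
  have h2 : ∀ x y : G, (powerGraph G).Adj x y → 2 ≤ f x - f y ∨ 2 ≤ -(f x - f y) := fun x y h =>
    le_abs.1 ((isLabelling_powerGraph_iff.1 hf).1 x y h)
  have ha1 : ∀ x : G, x ≠ 1 → 2 ≤ f x - f 1 ∨ 2 ≤ -(f x - f 1) := fun x hx =>
    h2 x 1 (powerGraph_adj_iff.2 ⟨hx, .inr (one_mem _)⟩)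
  have haz : ∀ x : G, x ≠ z → 2 ≤ f x - f z ∨ 2 ≤ -(f x - f z) := fun x hx => by
    by_cases hx1 : x = 1
    · subst hx1; have := ha1 z hz1; omega
    · exact h2 x z (powerGraph_adj_iff.2 ⟨hx, .inr (hz x hx1)⟩)
  have hu1 : ∀ x, f x ≠ f 1 + 1 ∧ f x ≠ f 1 - 1 := by
    intro x
    by_cases hx : x = 1
    · subst hx; omega
    · have := ha1 x hx; omega
  have huz : ∀ x, f x ≠ f z + 1 ∧ f x ≠ f z - 1 := by
    intro x
    by_cases hx : x = z
    · subst hx; omega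
    · have := haz x hx; omega
  have key : ∀ s t : ℤ, s ≠ t → (∀ x, f x ≠ s) → (∀ x, f x ≠ t) → (∃ x, f x ≤ s) →
      (∃ x, s ≤ f x) → (∃ x, f x ≤ t) → (∃ x, t ≤ f x) → (Nat.card G : ℤ) + 1 ≤ span f := by
    intro s t hst h1 h2 h3 h4 h5 h6
    have := card_add_card_le hinj (T := {s, t}) (by
      simp only [Finset.mem_insert, Finset.mem_singleton, forall_eq_or_imp, forall_eq]
      exact ⟨⟨h1, h3, h4⟩, h2, h5, h6⟩)
    rw [Finset.card_pair hst] at this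
    push_cast at this
    omega
  have hz1' := ha1 z hz1
  have hw1' := ha1 w hw1
  have hwz' := haz w hwz
  by_cases hup : (∃ x, f 1 + 1 ≤ f x) ∧ ∃ x, f z + 1 ≤ f x
  · exact key (f 1 + 1) (f z + 1) (by omega) (fun x => (hu1 x).1) (fun x => (huz x).1)
      ⟨1, by omega⟩ hup.1 ⟨z, by omega⟩ hup.2
  by_cases hlow : (∃ x, f x ≤ f 1 - 1) ∧ ∃ x, f x ≤ f z - 1
  · exact key (f 1 - 1) (f z - 1) (by omega) (fun x => (hu1 x).2) (fun x => (huz x).2)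
      hlow.1 ⟨1, by omega⟩ hlow.2 ⟨z, by omega⟩
  rw [not_and_or] at hup hlow
  simp only [not_exists, not_le] at hup hlow
  rcases hz1' with hz1' | hz1'
  · refine key (f 1 + 1) (f z - 1) ?_ (fun x => (hu1 x).1) (fun x => (huz x).2)
      ⟨1, by omega⟩ ⟨z, by omega⟩ ⟨1, by omega⟩ ⟨z, by omega⟩
    rcases hup with h | h
    · have := h z; omega
    rcases hlow with h' | h'
    · have := h w; have := h' w; omega
    · have := h' 1; omega
  · refine key (f 1 - 1) (f z + 1) ?_ (fun x => (hu1 x).2) (fun x => (huz x).1)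
      ⟨z, by omega⟩ ⟨1, by omega⟩ ⟨z, by omega⟩ ⟨1, by omega⟩
    rcases hup with h | h
    · rcases hlow with h' | h'
      · have := h' z; omega
      · have := h w; have := h' w; omega
    · have := h 1; omega

/-- In a complete graph the label just above each vertex is unused, and it lies within the range
except for the top vertex. -/
theorem lambda_of_forall_adj (hadj : ∀ a b : G, a ≠ b → (powerGraph G).Adj a b) :
    lambda (powerGraph G) = 2 * ((Nat.card G : ℤ) - 1) := by
  classical
  have := Fintype.ofFinite G
  apply le_antisymm
  · have hcard : 0 < Nat.card G := Nat.card_pos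
    let e := Finite.equivFin G
    have h2 : ∀ a b, a ≠ b → 2 ≤ |2 * ((e a : ℕ) : ℤ) - 2 * ((e b : ℕ) : ℤ)| := by
      intro a b hab
      have : (e a : ℕ) ≠ e b := fun h => hab (e.injective (Fin.ext h))
      rw [le_abs]
      omega
    refine lambda_le (f := fun x => 2 * ((e x : ℕ) : ℤ)) (isLabelling_powerGraph_iff.2
      ⟨fun a b hab => h2 a b hab.ne, fun a b hab => (by norm_num : (1 : ℤ) ≤ 2).trans (h2 a b hab)⟩)
      (fun x => by positivity) (fun x => ?_)
    have := (e x).2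
    omega
  · refine le_lambda fun f hf => ?_
    have hinj := injective_of_isLabelling hf
    have h2 : ∀ a b, a ≠ b → 2 ≤ f a - f b ∨ 2 ≤ -(f a - f b) := fun a b hab =>
      le_abs.1 ((isLabelling_powerGraph_iff.1 hf).1 a b (hadj a b hab))
    obtain ⟨x, hx⟩ := Finite.exists_max f
    have hcard := card_add_card_le hinj (T := (Finset.univ.erase x).image fun y => f y + 1) (by
      simp only [Finset.mem_image, Finset.mem_erase, Finset.mem_univ, and_true, forall_exists_index,
        and_imp]
      rintro _ y hy rfl
      refine ⟨fun w hw => ?_, ⟨y, by omega⟩, x, ?_⟩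
      · rcases eq_or_ne w y with rfl | hwy
        · omega
        · have := h2 w y hwy; omega
      · have := h2 y x hy; have := hx y; omega)
    rw [Finset.card_image_of_injective _ fun a b hab => hinj (by simpa using hab),
      Finset.card_erase_of_mem (Finset.mem_univ x), Finset.card_univ,
      ← Nat.card_eq_fintype_card] at hcard
    have : 0 < Nat.card G := Nat.card_pos
    omega

theorem two_le_abs_idxOf_sub_idxOf {α : Type*} [DecidableEq α] {R : α → α → Prop} {l : List α}
    (hl : l.IsChain fun a b => ¬ R a b) (hR : ∀ a b, R a b → R b a) {a b : α} (ha : a ∈ l)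
    (hb : b ∈ l) (hab : a ≠ b) (hRab : R a b) :
    2 ≤ |(l.idxOf a : ℤ) - l.idxOf b| := by
  have hchain := List.isChain_iff_getElem.1 hl
  have key : ∀ c d : α, c ∈ l → d ∈ l → R c d → l.idxOf d ≠ l.idxOf c + 1 := by
    intro c d hc hd hcd h
    have hd' := List.idxOf_lt_length_of_mem hd
    have := hchain (l.idxOf c) (by omega)
    simp only [← h, List.getElem_idxOf] at this
    exact this hcd
  have hne : l.idxOf a ≠ l.idxOf b := fun h => hab ((List.idxOf_inj ha).1 h)
  have h1 := key a b ha hb hRab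
  have h2 := key b a hb ha (hR _ _ hRab)
  rw [le_abs]
  omega

/-- The identity gets 0 and the list gets `2, …, |G|`, leaving only 1 unused. -/
theorem lambda_le_card {l : List G} (hnd : l.Nodup) (hmem : ∀ x, x ∈ l ↔ x ≠ 1)
    (hl : l.IsChain fun a b => ¬ (a ∈ zpowers b ∨ b ∈ zpowers a)) :
    lambda (powerGraph G) ≤ Nat.card G := by
  classical
  have := Fintype.ofFinite G
  have hlen : l.length + 1 = Nat.card G := by
    have h : l.toFinset = Finset.univ.erase 1 := by ext x; simp [hmem]
    have hpos : 0 < Nat.card G := Nat.card_pos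
    rw [← List.toFinset_card_of_nodup hnd, h, Finset.card_erase_of_mem (Finset.mem_univ _),
      Finset.card_univ, ← Nat.card_eq_fintype_card]
    omega
  let f : G → ℤ := fun x => if x = 1 then 0 else l.idxOf x + 2
  have hf1 : f 1 = 0 := if_pos rfl
  have hf : ∀ x, x ≠ 1 → f x = l.idxOf x + 2 := fun x hx => if_neg hx
  have hlt : ∀ x, x ≠ 1 → l.idxOf x < l.length := fun x hx =>
    List.idxOf_lt_length_of_mem ((hmem x).2 hx)
  refine lambda_le (f := f) (isLabelling_powerGraph_iff.2 ⟨fun a b hab => ?_, fun a b hab => ?_⟩)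
    (fun x => ?_) (fun x => ?_)
  · obtain ⟨hne, hab⟩ := powerGraph_adj_iff.1 hab
    rcases eq_or_ne a 1 with rfl | ha
    · rw [hf1, hf b hne.symm, le_abs]; omega
    rcases eq_or_ne b 1 with rfl | hb
    · rw [hf1, hf a hne, le_abs]; omega
    rw [hf a ha, hf b hb, add_sub_add_right_eq_sub]
    exact two_le_abs_idxOf_sub_idxOf hl (fun _ _ => Or.symm) ((hmem a).2 ha) ((hmem b).2 hb) hne hab
  · rcases eq_or_ne a 1 with rfl | ha
    · rw [hf1, hf b hab.symm, le_abs]; omega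
    rcases eq_or_ne b 1 with rfl | hb
    · rw [hf1, hf a hab, le_abs]; omega
    have := mt (List.idxOf_inj ((hmem a).2 ha)).1 hab
    rw [hf a ha, hf b hb, le_abs]; omega
  · rcases eq_or_ne x 1 with rfl | hx
    · rw [hf1]
    · rw [hf x hx]; positivity
  · rcases eq_or_ne x 1 with rfl | hx
    · rw [hf1]; positivity
    · have := hlt x hx
      rw [hf x hx]; omega

/-- The two dominating vertices go to the ends, `1` at 0 and `z` at `|G| + 1`, each separated from
the list by one unused label. -/
theorem lambda_le_card_add_one {z : G} (hz1 : z ≠ 1) {l : List G} (hnd : l.Nodup)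
    (hmem : ∀ x, x ∈ l ↔ x ≠ 1 ∧ x ≠ z)
    (hl : l.IsChain fun a b => ¬ (a ∈ zpowers b ∨ b ∈ zpowers a)) :
    lambda (powerGraph G) ≤ Nat.card G + 1 := by
  classical
  have := Fintype.ofFinite G
  have hlen : l.length + 2 = Nat.card G := by
    have h : insert 1 (insert z l.toFinset) = Finset.univ := by
      ext x
      have := hmem x
      simp only [Finset.mem_insert, List.mem_toFinset, Finset.mem_univ, iff_true]
      tauto
    have h1 : z ∉ l.toFinset := by simp [hmem]
    have h2 : 1 ∉ insert z l.toFinset := by simp [hmem, hz1.symm]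
    rw [Nat.card_eq_fintype_card, ← Finset.card_univ, ← h, Finset.card_insert_of_notMem h2,
      Finset.card_insert_of_notMem h1, List.toFinset_card_of_nodup hnd]
  let f : G → ℤ := fun x => if x = 1 then 0 else if x = z then l.length + 3 else l.idxOf x + 2
  have hf1 : f 1 = 0 := if_pos rfl
  have hfz : f z = l.length + 3 := by simp [f, hz1]
  have hf : ∀ x, x ≠ 1 → x ≠ z → f x = l.idxOf x + 2 := fun x hx hxz => by simp [f, hx, hxz]
  have hlt : ∀ x, x ≠ 1 → x ≠ z → l.idxOf x < l.length := fun x hx hxz =>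
    List.idxOf_lt_length_of_mem ((hmem x).2 ⟨hx, hxz⟩)
  have hdom : ∀ a b, a ≠ b → (a = 1 ∨ a = z ∨ b = 1 ∨ b = z) → 2 ≤ |f a - f b| := by
    have key : ∀ a b, a ≠ b → (a = 1 ∨ a = z) → 2 ≤ |f a - f b| := by
      rintro a b hab (rfl | rfl)
      · rcases eq_or_ne b z with rfl | hb
        · rw [hf1, hfz, le_abs]; omega
        · rw [hf1, hf b hab.symm hb, le_abs]; omega
      · rcases eq_or_ne b 1 with rfl | hb
        · rw [hf1, hfz, le_abs]; omega
        · have := hlt b hb hab.symm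
          rw [hfz, hf b hb hab.symm, le_abs]; omega
    intro a b hab h
    by_cases ha : a = 1 ∨ a = z
    · exact key a b hab ha
    · rw [abs_sub_comm]
      exact key b a hab.symm (by tauto)
  refine lambda_le (f := f) (isLabelling_powerGraph_iff.2 ⟨fun a b hab => ?_, fun a b hab => ?_⟩)
    (fun x => ?_) (fun x => ?_)
  · obtain ⟨hne, hab⟩ := powerGraph_adj_iff.1 hab
    by_cases h : a = 1 ∨ a = z ∨ b = 1 ∨ b = z
    · exact hdom a b hne h
    · simp only [not_or] at h
      rw [hf a h.1 h.2.1, hf b h.2.2.1 h.2.2.2, add_sub_add_right_eq_sub]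
      exact two_le_abs_idxOf_sub_idxOf hl (fun _ _ => Or.symm) ((hmem a).2 ⟨h.1, h.2.1⟩)
        ((hmem b).2 h.2.2) hne hab
  · by_cases h : a = 1 ∨ a = z ∨ b = 1 ∨ b = z
    · have := hdom a b hab h; omega
    · simp only [not_or] at h
      have := mt (List.idxOf_inj ((hmem a).2 ⟨h.1, h.2.1⟩)).1 hab
      rw [hf a h.1 h.2.1, hf b h.2.2.1 h.2.2.2, le_abs]; omega
  all_goals
    rcases eq_or_ne x 1 with rfl | hx
    · have := hf1; omega
    rcases eq_or_ne x z with rfl | hxz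
    · rw [hfz]; omega
    have := hlt x hx hxz
    rw [hf x hx hxz]; omega

end Labelling

/-! ### Incomparable translates and the three cases -/

section PGroup

variable {G : Type*} [Group G] {p : ℕ}

theorem mul_incomparable_of_not_commute {a g x : G} (hg : g * a ≠ a * g) (hx : x ∈ zpowers a) :
    (g * x) * a ≠ a * (g * x) ∧ g * x ∉ zpowers a ∧ a ∉ zpowers (g * x) := by
  have hxa : x * a = a * x := by
    obtain ⟨k, rfl⟩ := mem_zpowers_iff.1 hx
    exact ((Commute.refl a).zpow_left k).eq
  have h : (g * x) * a ≠ a * (g * x) := by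
    rw [mul_assoc, hxa, ← mul_assoc, ← mul_assoc]
    exact fun h => hg (mul_right_cancel h)
  refine ⟨h, fun hmem => ?_, fun hmem => ?_⟩
  · obtain ⟨k, hk⟩ := mem_zpowers_iff.1 hmem
    exact h (hk ▸ ((Commute.refl a).zpow_left k).eq)
  · obtain ⟨k, hk⟩ := mem_zpowers_iff.1 hmem
    have := ((Commute.refl (g * x)).zpow_right k).eq
    rw [hk] at this
    exact h this

/-- Suppose `a = (q * x) ^ k` with `x = a ^ i`. If `p` does not divide `k`, then `q ^ k ∈ ⟨a⟩` and
hence `q ∈ ⟨a⟩`. If it does, `q` drops out and `a = a ^ (i * k)` with `p ∣ i * k`, impossible since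
`p` divides the order of `a`. -/
theorem mul_incomparable_of_commute [Fact p.Prime] (hG : IsPGroup p G) {a q x : G} (ha : a ≠ 1)
    (hq : q ^ p = 1) (hqa : q ∉ zpowers a) (hcomm : q * a = a * q) (hx : x ∈ zpowers a) :
    q * x ∉ zpowers a ∧ a ∉ zpowers (q * x) := by
  refine ⟨fun h => hqa (((zpowers a).mul_mem_cancel_right hx).1 h), fun h => ?_⟩
  obtain ⟨i, rfl⟩ := mem_zpowers_iff.1 hx
  obtain ⟨k, hk⟩ := mem_zpowers_iff.1 h
  rw [((show Commute q a from hcomm).zpow_right i).mul_zpow, ← zpow_mul] at hk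
  have hpk : (p : ℤ) ∣ k := by
    by_contra hpk
    obtain ⟨u, v, huv⟩ :=
      ((Nat.prime_iff_prime_int.1 (Fact.out : p.Prime)).coprime_iff_not_dvd.2 hpk)
    refine hqa ?_
    have hqk : q ^ k ∈ zpowers a := ⟨1 - i * k, by
      change a ^ (1 - i * k) = q ^ k
      rw [zpow_sub, zpow_one, mul_inv_eq_iff_eq_mul, hk]⟩
    have : q = (q ^ k) ^ v := by
      rw [← zpow_mul]
      nth_rewrite 1 [← zpow_one q]
      rw [← huv, zpow_add, mul_comm u, zpow_mul, zpow_natCast, hq, one_zpow, one_mul, mul_comm]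
    rw [this]
    exact zpow_mem hqk v
  obtain ⟨k, rfl⟩ := hpk
  rw [zpow_mul, zpow_natCast, hq, one_zpow, one_mul] at hk
  have hdvd : (orderOf a : ℤ) ∣ i * (p * k) - 1 := by
    rw [orderOf_dvd_iff_zpow_eq_one, zpow_sub, hk, zpow_one, mul_inv_cancel]
  have hp1 : (p : ℤ) ∣ 1 := by
    have h2 := (Int.natCast_dvd_natCast.2 (hG.dvd_orderOf ha)).trans hdvd
    exact (dvd_sub_right (Dvd.intro (i * k) (by ring))).1 h2
  exact (Fact.out : p.Prime).one_lt.ne' (by exact_mod_cast Int.eq_one_of_dvd_one (by positivity) hp1)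

variable [Finite G]

/-- In a cyclic group `x ^ m = 1` has at most `m` solutions; for `m = orderOf b` they are therefore
exactly the elements of `⟨b⟩`. -/
theorem mem_zpowers_of_orderOf_dvd {a b c : G} (ha : a ∈ zpowers c) (hb : b ∈ zpowers c)
    (h : orderOf a ∣ orderOf b) : a ∈ zpowers b := by
  classical
  have := Fintype.ofFinite (zpowers c)
  let b' : zpowers c := ⟨b, hb⟩
  have hob : orderOf b' = orderOf b := (orderOf_injective (zpowers c).subtype
    Subtype.val_injective b').symm
  have hle := IsCyclic.card_pow_eq_one_le (α := zpowers c) (orderOf_pos b')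
  have hsub : (zpowers b' : Set (zpowers c)).toFinset ⊆
      Finset.univ.filter fun x : zpowers c => x ^ orderOf b' = 1 := by
    intro x hx
    rw [Set.mem_toFinset, SetLike.mem_coe] at hx
    simpa using orderOf_dvd_iff_pow_eq_one.1 (orderOf_dvd_of_mem_zpowers hx)
  have hcard : (zpowers b' : Set (zpowers c)).toFinset.card = orderOf b' := by
    rw [Set.toFinset_card, ← Nat.card_eq_fintype_card]
    exact Nat.card_zpowers b'
  have heq := Finset.eq_of_subset_of_card_le hsub (hle.trans_eq hcard.symm)
  have hmem : (⟨a, ha⟩ : zpowers c) ∈ (zpowers b' : Set (zpowers c)).toFinset := by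
    rw [heq, Finset.mem_filter]
    refine ⟨Finset.mem_univ _, Subtype.ext ?_⟩
    rw [hob]
    exact orderOf_dvd_iff_pow_eq_one.1 h
  rw [Set.mem_toFinset, SetLike.mem_coe] at hmem
  obtain ⟨k, hk⟩ := mem_zpowers_iff.1 hmem
  exact ⟨k, congrArg Subtype.val hk⟩

theorem _root_.IsPGroup.mem_zpowers_of_orderOf_le [Fact p.Prime] (hG : IsPGroup p G) {a b c : G}
    (ha : a ∈ zpowers c) (hb : b ∈ zpowers c) (h : orderOf a ≤ orderOf b) : a ∈ zpowers b := by
  refine mem_zpowers_of_orderOf_dvd ha hb ?_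
  obtain ⟨i, hi⟩ := IsPGroup.iff_orderOf.1 hG a
  obtain ⟨j, hj⟩ := IsPGroup.iff_orderOf.1 hG b
  rw [hi, hj] at h ⊢
  exact pow_dvd_pow p ((Nat.pow_le_pow_iff_right (Fact.out : p.Prime).one_lt).1 h)

/-- The translate `g⟨a⟩` provides `|⟨a⟩|` elements of `S` incomparable to `a`, whereas fewer than
`|⟨a⟩|` elements of `S` lie below `a` because `1 ∉ S`. The forest condition, with the order of an
element as height, holds because subgroups of a cyclic `p`-group form a chain. -/
theorem exists_list_isChain_not_mem_zpowers [Fact p.Prime] (hG : IsPGroup p G) (S : Set G)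
    (h1 : 1 ∉ S) (hS : ∀ a ∈ S, ∃ g : G, ∀ x ∈ zpowers a,
      g * x ∈ S ∧ g * x ∉ zpowers a ∧ a ∉ zpowers (g * x)) :
    ∃ l : List G, l.Nodup ∧ (∀ x, x ∈ l ↔ x ∈ S) ∧
      l.IsChain fun a b => ¬ (a ∈ zpowers b ∨ b ∈ zpowers a) := by
  classical
  have := Fintype.ofFinite G
  obtain ⟨l, hnd, hl, hchain⟩ := exists_list_isChain_incomparable S.toFinset
    (fun a b => a ∈ zpowers b) orderOf (fun a => mem_zpowers a)
    (fun a b h => Nat.le_of_dvd (orderOf_pos b) (orderOf_dvd_of_mem_zpowers h))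
    (fun a b c => hG.mem_zpowers_of_orderOf_le) (fun a ha => by
      simp only [Set.mem_toFinset] at ha ⊢
      obtain ⟨g, hg⟩ := hS a ha
      calc _ < (zpowers a : Set G).ncard := by
            refine Set.ncard_lt_ncard ⟨fun x hx => hx.2, fun hsub => ?_⟩
            exact h1 (hsub (one_mem (zpowers a))).1
        _ ≤ _ := Set.ncard_le_ncard_of_injOn (fun x => g * x) (fun x hx => hg x hx)
            (fun x _ y _ hxy => mul_left_cancel hxy))
  exact ⟨l, hnd, fun x => by rw [← List.mem_toFinset, hl, Set.mem_toFinset], hchain⟩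

theorem exists_pow_eq_one_not_mem_zpowers [Fact p.Prime] (hG : IsPGroup p G) (hc : ¬ IsCyclic G)
    (hQ : ¬ IsGeneralizedQuaternion G) {a : G} (ha : a ≠ 1) :
    ∃ q : G, q ^ p = 1 ∧ q ∉ zpowers a := by
  by_contra! hroot
  have hdvd := hG.dvd_orderOf ha
  have hac : orderOf (a ^ (orderOf a / p)) = p := orderOf_pow_orderOf_div (orderOf_pos a).ne' hdvd
  refine (isCyclic_or_isGeneralizedQuaternion Fact.out hG hac fun x hx => ?_).elim hc hQ
  refine mem_zpowers_of_orderOf_dvd (hroot x hx) (pow_mem (mem_zpowers a) _) ?_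
  rw [hac]
  exact orderOf_dvd_of_pow_eq_one hx

theorem lambda_eq_card [Fact p.Prime] (hG : IsPGroup p G) (hc : ¬ IsCyclic G)
    (hQ : ¬ IsGeneralizedQuaternion G) : lambda (powerGraph G) = Nat.card G := by
  have : Nontrivial G := by
    by_contra h
    rw [not_nontrivial_iff_subsingleton] at h
    exact hc inferInstance
  refine le_antisymm ?_ card_le_lambda
  obtain ⟨l, hnd, hmem, hl⟩ := exists_list_isChain_not_mem_zpowers hG {x : G | x ≠ 1} (by simp) (by
    intro a ha
    by_cases hcent : ∀ g : G, g * a = a * g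
    · obtain ⟨q, hq, hqa⟩ := exists_pow_eq_one_not_mem_zpowers hG hc hQ ha
      refine ⟨q, fun x hx => ?_⟩
      obtain ⟨h1, h2⟩ := mul_incomparable_of_commute hG ha hq hqa (hcent q) hx
      exact ⟨fun h => h1 (h ▸ one_mem _), h1, h2⟩
    · push Not at hcent
      obtain ⟨g, hg⟩ := hcent
      refine ⟨g, fun x hx => ?_⟩
      obtain ⟨-, h1, h2⟩ := mul_incomparable_of_not_commute hg hx
      exact ⟨fun h => h1 (h ▸ one_mem _), h1, h2⟩)
  exact lambda_le_card hnd hmem hl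

theorem lambda_of_isCyclic [Fact p.Prime] (hG : IsPGroup p G) [hc : IsCyclic G] :
    lambda (powerGraph G) = 2 * ((Nat.card G : ℤ) - 1) := by
  obtain ⟨c, hc⟩ := hc
  refine lambda_of_forall_adj fun a b hab => powerGraph_adj_iff.2 ⟨hab, ?_⟩
  exact (le_total (orderOf a) (orderOf b)).imp (hG.mem_zpowers_of_orderOf_le (hc a) (hc b))
    (hG.mem_zpowers_of_orderOf_le (hc b) (hc a))

theorem two_mul_eq_zero_iff {N : ℕ} (i : ZMod (2 * N)) : 2 * i = 0 ↔ i = 0 ∨ i = N := by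
  obtain ⟨k, rfl⟩ := ZMod.intCast_surjective i
  have h1 : (2 * (k : ZMod (2 * N)) = 0) ↔ ((2 * N : ℕ) : ℤ) ∣ 2 * k := by
    rw [← ZMod.intCast_zmod_eq_zero_iff_dvd]; push_cast; rfl
  have h2 : ((k : ZMod (2 * N)) = N) ↔ ((2 * N : ℕ) : ℤ) ∣ k - N := by
    rw [← ZMod.intCast_zmod_eq_zero_iff_dvd]; push_cast; rw [sub_eq_zero]
  rw [h1, h2, ZMod.intCast_zmod_eq_zero_iff_dvd]
  push_cast
  rw [mul_dvd_mul_iff_left two_ne_zero]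
  constructor
  · rintro ⟨t, rfl⟩
    rcases Int.even_or_odd' t with ⟨s, rfl | rfl⟩
    · exact .inl ⟨s, by ring⟩
    · exact .inr ⟨s, by ring⟩
  · rintro (⟨t, rfl⟩ | ⟨t, ht⟩)
    · exact ⟨2 * t, by ring⟩
    · exact ⟨2 * t + 1, by linear_combination ht⟩

theorem natCast_ne_zero_of_two_mul {N : ℕ} (hN : 0 < N) : (N : ZMod (2 * N)) ≠ 0 := by
  rw [Ne, ZMod.natCast_eq_zero_iff]
  exact fun h => by have := Nat.le_of_dvd hN h; omega

theorem quaternionGroup_involution {N : ℕ} (hN : 0 < N) {x : QuaternionGroup N} (hx : x ^ 2 = 1) :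
    x = 1 ∨ x = .a N := by
  rcases x with i | i
  · rw [sq, QuaternionGroup.a_mul_a, QuaternionGroup.one_def, QuaternionGroup.a.injEq, ← two_mul,
      two_mul_eq_zero_iff] at hx
    rw [QuaternionGroup.one_def, QuaternionGroup.a.injEq, QuaternionGroup.a.injEq]
    exact hx
  · rw [QuaternionGroup.xa_sq, QuaternionGroup.one_def, QuaternionGroup.a.injEq] at hx
    exact absurd hx (natCast_ne_zero_of_two_mul hN)

theorem quaternionGroup_center {N : ℕ} (hN : 2 ≤ N) {x : QuaternionGroup N}
    (hx : ∀ g, g * x = x * g) : x = 1 ∨ x = .a N := by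
  rcases x with i | i
  · have h := hx (.xa 0)
    rw [QuaternionGroup.xa_mul_a, QuaternionGroup.a_mul_xa, QuaternionGroup.xa.injEq, zero_add,
      zero_sub, eq_neg_iff_add_eq_zero, ← two_mul, two_mul_eq_zero_iff] at h
    rw [QuaternionGroup.one_def, QuaternionGroup.a.injEq, QuaternionGroup.a.injEq]
    exact h
  · have h := hx (.a 1)
    rw [QuaternionGroup.xa_mul_a, QuaternionGroup.a_mul_xa, QuaternionGroup.xa.injEq,
      sub_eq_iff_eq_add, add_assoc, left_eq_add] at h
    have h2 : ((2 : ℕ) : ZMod (2 * N)) = 0 := by push_cast; rw [← h]; norm_num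
    rw [ZMod.natCast_eq_zero_iff] at h2
    have := Nat.le_of_dvd (by omega) h2
    omega

theorem lambda_of_isGeneralizedQuaternion [Fact p.Prime] (hG : IsPGroup p G)
    (hQ : IsGeneralizedQuaternion G) : lambda (powerGraph G) = Nat.card G + 1 := by
  obtain ⟨e, he, ⟨φ⟩⟩ := hQ
  have hN : 2 ≤ 2 ^ (e - 1) := Nat.le_self_pow (by omega) 2
  generalize 2 ^ (e - 1) = N at φ hN
  obtain ⟨z, hz⟩ := φ.surjective (.a N)
  have hinv : ∀ x : G, x ^ 2 = 1 → x = 1 ∨ x = z := fun x hx => by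
    rw [← φ.injective.eq_iff, ← φ.injective.eq_iff (b := z), map_one, hz]
    exact quaternionGroup_involution (by omega) (by rw [← map_pow, hx, map_one])
  have hcent : ∀ x : G, (∀ g, g * x = x * g) → x = 1 ∨ x = z := fun x hx => by
    rw [← φ.injective.eq_iff, ← φ.injective.eq_iff (b := z), map_one, hz]
    refine quaternionGroup_center hN fun g => ?_
    obtain ⟨g, rfl⟩ := φ.surjective g
    rw [← map_mul, hx, map_mul]
  have hz1 : z ≠ 1 := by
    rw [Ne, ← φ.injective.eq_iff, hz, map_one, QuaternionGroup.one_def, QuaternionGroup.a.injEq]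
    exact natCast_ne_zero_of_two_mul (by omega)
  have hz2 : z ^ 2 = 1 := by
    rw [← φ.injective.eq_iff, map_pow, hz, map_one, sq, QuaternionGroup.a_mul_a, ← two_mul,
      QuaternionGroup.one_def, QuaternionGroup.a.injEq, two_mul_eq_zero_iff]
    exact .inr rfl
  obtain rfl : p = 2 := (Nat.prime_dvd_prime_iff_eq Fact.out Nat.prime_two).1
    ((hG.dvd_orderOf hz1).trans (orderOf_dvd_of_pow_eq_one hz2))
  -- Every nontrivial cyclic subgroup contains an involution, and `z` is the only one; so `z` is a
  -- dominating vertex.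
  have hzx : ∀ x : G, x ≠ 1 → z ∈ zpowers x := fun x hx => by
    have ho := orderOf_pow_orderOf_div (orderOf_pos x).ne' (hG.dvd_orderOf hx)
    rcases hinv (x ^ (orderOf x / 2)) (orderOf_dvd_iff_pow_eq_one.1 ho.dvd) with h | h
    · rw [h, orderOf_one] at ho
      omega
    · exact h ▸ pow_mem (mem_zpowers x) _
  obtain ⟨w, hw⟩ := φ.surjective (.xa 0)
  have hw1 : w ≠ 1 := by
    rw [Ne, ← φ.injective.eq_iff, hw, map_one, QuaternionGroup.one_def]
    exact fun h => nomatch h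
  have hwz : w ≠ z := by
    rw [Ne, ← φ.injective.eq_iff, hw, hz]
    simp
  refine le_antisymm ?_ (card_add_one_le_lambda hz1 hw1 hwz hzx)
  obtain ⟨l, hnd, hmem, hl⟩ := exists_list_isChain_not_mem_zpowers hG {x : G | x ≠ 1 ∧ x ≠ z}
    (by simp) (by
    intro a ha
    obtain ⟨g, hg⟩ : ∃ g, g * a ≠ a * g := by
      by_contra! h
      exact (hcent a h).elim ha.1 ha.2
    refine ⟨g, fun x hx => ?_⟩
    obtain ⟨-, h1, h2⟩ := mul_incomparable_of_not_commute hg hx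
    exact ⟨⟨fun h => h1 (h ▸ one_mem _), fun h => h1 (h ▸ hzx a ha.1)⟩, h1, h2⟩)
  exact lambda_le_card_add_one hz1 hnd hmem hl

end PGroup
end LambdaNumber

theorem mainTheorem1 (p : ℕ) (hp : p.Prime) (G : Type*) [Group G] [Finite G]
    (hG : IsPGroup p G) :
    (Nat.card G ≠ 2 →
      (LambdaNumber.lambda (LambdaNumber.powerGraph G) = (Nat.card G : ℤ) ↔
        ¬ IsCyclic G ∧ ¬ LambdaNumber.IsGeneralizedQuaternion G)) ∧
    (∀ e : ℕ, Monoid.exponent G = p ^ e → IsCyclic G →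
      LambdaNumber.lambda (LambdaNumber.powerGraph G) = 2 * ((p : ℤ) ^ e - 1)) ∧
    (LambdaNumber.IsGeneralizedQuaternion G →
      LambdaNumber.lambda (LambdaNumber.powerGraph G) = (Nat.card G : ℤ) + 1) ∧
    (¬ IsCyclic G → ¬ LambdaNumber.IsGeneralizedQuaternion G →
      LambdaNumber.lambda (LambdaNumber.powerGraph G) = (Nat.card G : ℤ)) := by
  have := Fact.mk hp
  refine ⟨fun h2 => ⟨fun h => ⟨fun hc => ?_, fun hQ => ?_⟩, fun h => ?_⟩, fun e he hc => ?_,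
    LambdaNumber.lambda_of_isGeneralizedQuaternion hG, LambdaNumber.lambda_eq_card hG⟩
  -- `2 * (|G| - 1) = |G|` happens only for `|G| = 2`, the excluded order.
  · rw [LambdaNumber.lambda_of_isCyclic hG] at h
    omega
  · rw [LambdaNumber.lambda_of_isGeneralizedQuaternion hG hQ] at h
    omega
  · exact LambdaNumber.lambda_eq_card hG h.1 h.2
  · rw [LambdaNumber.lambda_of_isCyclic hG, ← IsCyclic.exponent_eq_card, he]
    push_cast
    rfl
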